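/- Let $\mathbb{k}$ be a field and let $H$ be a pointed Hopf algebra over $\mathbb{k}$, i.e. every simple subcoalgebra of $H$ is one-dimensional. Let $\operatorname{corad}(H)$ be the coradical of $H$ (the sum of all simple subcoalgebras), which is a subalgebra of $H$ since $H$ is pointed, and let $H_0\subseteq H_1\subseteq\cdots$ be the coradical filtration, $H_0=\operatorname{corad}(H)$ and $H_{n+1}=\Delta^{-1}(H_0\otimes H+H\otimes H_n)$. Let $\operatorname{gr}_c H=\bigoplus_{n\ge 0}H_n/H_{n-1}$ (with $H_{-1}=0$) be the associated graded Hopf algebra. If $\operatorname{gr}_c H$ is left or right Noetherian (in particular, if it is Noetherian), then $\operatorname{corad}(H)$, $\operatorname{gr}_c H$ and $H$ are all affine, i.e. finitely generated as $\mathbb{k}$-algebras. -/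

import Mathlib

open Coalgebra TensorProduct DirectSum

section Coalgebras

variable (k : Type*) {C : Type*} [Field k] [AddCommGroup C] [Module k C] [Coalgebra k C]

/-- A subcoalgebra: a subspace `D` with `Δ(D) ⊆ D ⊗ D`. -/
def IsSubcoalgebra (D : Submodule k C) : Prop :=
  ∀ x ∈ D, comul (R := k) x ∈ LinearMap.range (TensorProduct.map D.subtype D.subtype)

/-- A simple subcoalgebra: a nonzero subcoalgebra with no subcoalgebras but zero and itself. -/
structure IsSimpleSubcoalgebra (D : Submodule k C) : Prop where
  isSubcoalgebra : IsSubcoalgebra k D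
  ne_bot : D ≠ ⊥
  eq_bot_or_eq : ∀ E : Submodule k C, IsSubcoalgebra k E → E ≤ D → E = ⊥ ∨ E = D

variable (C)

/-- The coradical: the sum of all simple subcoalgebras. -/
def coradical : Submodule k C := sSup {D | IsSimpleSubcoalgebra k D}

/-- A coalgebra is pointed if every simple subcoalgebra is one-dimensional. -/
class IsPointedCoalgebra : Prop where
  finrank_eq_one : ∀ D : Submodule k C, IsSimpleSubcoalgebra k D → Module.finrank k D = 1

variable {C} in
/-- The wedge `X ∧ Y = Δ⁻¹(X ⊗ C + C ⊗ Y)` of two subspaces. -/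
def coalgebraWedge (X Y : Submodule k C) : Submodule k C :=
  (LinearMap.range (X.subtype.rTensor C) ⊔ LinearMap.range (Y.subtype.lTensor C)).comap
    (comul (R := k) (A := C))

/-- The coradical filtration: `C₀` is the coradical, and `Cₙ₊₁ = C₀ ∧ Cₙ`. -/
def coradicalFiltration : ℕ → Submodule k C
  | 0 => coradical k C
  | n + 1 => coalgebraWedge k (coradical k C) (coradicalFiltration n)

end Coalgebras

/-- The filtration `F` shifted by one: `0, F₀, F₁, …`. -/
def shiftFiltration {k A : Type*} [Field k] [AddCommGroup A] [Module k A]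
    (F : ℕ → Submodule k A) : ℕ → Submodule k A
  | 0 => ⊥
  | n + 1 => F n

section AssociatedGraded

variable {k A : Type*} [Field k] [Ring A] [Algebra k A]
  (F : ℕ → Submodule k A)

/-- The homogeneous component `Fₙ / Fₙ₋₁` (with `F₋₁ = 0`). -/
def GradedPiece (n : ℕ) : Type _ := F n ⧸ (shiftFiltration F n).submoduleOf (F n)

instance GradedPiece.addCommGroup (n : ℕ) : AddCommGroup (GradedPiece F n) :=
  inferInstanceAs (AddCommGroup (F n ⧸ (shiftFiltration F n).submoduleOf (F n)))

instance GradedPiece.module (n : ℕ) : Module k (GradedPiece F n) :=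
  inferInstanceAs (Module k (F n ⧸ (shiftFiltration F n).submoduleOf (F n)))

variable {F}

/-- The class in `Fₙ / Fₙ₋₁` of an element of `Fₙ`. -/
def GradedPiece.mk (n : ℕ) (x : F n) : GradedPiece F n :=
  Submodule.Quotient.mk (p := (shiftFiltration F n).submoduleOf (F n)) x

theorem GradedPiece.mk_eq_mk {n : ℕ} {x y : F n} :
    GradedPiece.mk n x = GradedPiece.mk n y ↔ (x - y : A) ∈ shiftFiltration F n :=
  Submodule.Quotient.eq _

theorem GradedPiece.sigma_ext {i j : ℕ} (h : i = j) {x : F i} {y : F j} (hxy : (x : A) = y) :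
    GradedMonoid.mk (A := GradedPiece F) i (GradedPiece.mk i x) =
      GradedMonoid.mk j (GradedPiece.mk j y) := by
  subst h
  obtain rfl : x = y := Subtype.ext hxy
  rfl

variable [SetLike.GradedMonoid F]

theorem mul_mem_shift_left {i j : ℕ} {x y : A} (hx : x ∈ shiftFiltration F i) (hy : y ∈ F j) :
    x * y ∈ shiftFiltration F (i + j) := by
  cases i with
  | zero =>
    obtain rfl : x = 0 := by simpa [shiftFiltration] using hx
    simp
  | succ i =>
    rw [Nat.succ_add]
    exact SetLike.mul_mem_graded (A := F) hx hy

theorem mul_mem_shift_right {i j : ℕ} {x y : A} (hx : x ∈ F i) (hy : y ∈ shiftFiltration F j) :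
    x * y ∈ shiftFiltration F (i + j) := by
  cases j with
  | zero =>
    obtain rfl : y = 0 := by simpa [shiftFiltration] using hy
    simp
  | succ j => exact SetLike.mul_mem_graded (A := F) hx hy

/-- The product `Fᵢ/Fᵢ₋₁ × Fⱼ/Fⱼ₋₁ → Fᵢ₊ⱼ/Fᵢ₊ⱼ₋₁` induced by the product of `A`. -/
def GradedPiece.mul {i j : ℕ} : GradedPiece F i → GradedPiece F j → GradedPiece F (i + j) :=
  Quotient.map₂ (fun x y => ⟨(x : A) * y, SetLike.mul_mem_graded x.2 y.2⟩) (by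
    intro a a' ha b b' hb
    replace ha : (a - a' : A) ∈ shiftFiltration F i :=
      (Submodule.quotientRel_def ((shiftFiltration F i).submoduleOf (F i))).mp ha
    replace hb : (b - b' : A) ∈ shiftFiltration F j :=
      (Submodule.quotientRel_def ((shiftFiltration F j).submoduleOf (F j))).mp hb
    refine (Submodule.quotientRel_def _).mpr ?_
    change (a * b - a' * b' : A) ∈ shiftFiltration F (i + j)
    have : (a * b - a' * b' : A) = (a - a') * b + a' * (b - b') := by noncomm_ring
    rw [this]
    exact add_mem (mul_mem_shift_left ha b.2) (mul_mem_shift_right a'.2 hb))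

theorem GradedPiece.mk_mul_mk {i j : ℕ} (x : F i) (y : F j) :
    GradedPiece.mul (GradedPiece.mk i x) (GradedPiece.mk j y) =
      GradedPiece.mk (i + j) ⟨(x : A) * y, SetLike.mul_mem_graded x.2 y.2⟩ := rfl

instance GradedPiece.gOne : GradedMonoid.GOne (GradedPiece F) where
  one := GradedPiece.mk 0 ⟨1, SetLike.one_mem_graded F⟩

instance GradedPiece.gMul : GradedMonoid.GMul (GradedPiece F) where
  mul := GradedPiece.mul

instance GradedPiece.gRing : DirectSum.GRing (GradedPiece F) where
  mul_zero := by
    rintro i j ⟨a⟩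
    exact congrArg (GradedPiece.mk (i + j)) (Subtype.ext (mul_zero (a : A)))
  zero_mul := by
    rintro i j ⟨a⟩
    exact congrArg (GradedPiece.mk (i + j)) (Subtype.ext (zero_mul (a : A)))
  mul_add := by
    rintro i j ⟨a⟩ ⟨b⟩ ⟨c⟩
    exact congrArg (GradedPiece.mk (i + j)) (Subtype.ext (mul_add (a : A) b c))
  add_mul := by
    rintro i j ⟨a⟩ ⟨b⟩ ⟨c⟩
    exact congrArg (GradedPiece.mk (i + j)) (Subtype.ext (add_mul (a : A) b c))
  one_mul := by
    rintro ⟨i, ⟨a⟩⟩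
    exact GradedPiece.sigma_ext (zero_add i) (one_mul (a : A))
  mul_one := by
    rintro ⟨i, ⟨a⟩⟩
    exact GradedPiece.sigma_ext (add_zero i) (mul_one (a : A))
  mul_assoc := by
    rintro ⟨i, ⟨a⟩⟩ ⟨j, ⟨b⟩⟩ ⟨l, ⟨c⟩⟩
    exact GradedPiece.sigma_ext (add_assoc i j l) (mul_assoc (a : A) b c)
  natCast n := GradedPiece.mk 0 (n • ⟨1, SetLike.one_mem_graded F⟩)
  natCast_zero := by rw [zero_smul]; rfl
  natCast_succ n := by rw [succ_nsmul]; rfl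
  intCast n := GradedPiece.mk 0 (n • ⟨1, SetLike.one_mem_graded F⟩)
  intCast_ofNat n := by rw [natCast_zsmul]
  intCast_negSucc_ofNat n := by rw [negSucc_zsmul]; rfl

instance GradedPiece.gAlgebra : DirectSum.GAlgebra k (GradedPiece F) where
  toFun :=
    { toFun := fun r => GradedPiece.mk 0 (r • ⟨1, SetLike.one_mem_graded F⟩)
      map_zero' := by rw [zero_smul]; rfl
      map_add' := fun r s => by rw [add_smul]; rfl }
  map_one := by
    change GradedPiece.mk 0 ((1 : k) • _) = _
    rw [one_smul]; rfl
  map_mul r s := GradedPiece.sigma_ext rfl (by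
    change (r * s) • (1 : A) = (r • (1 : A)) * (s • (1 : A))
    rw [smul_mul_smul_comm, mul_one])
  commutes := by
    rintro r ⟨i, ⟨a⟩⟩
    exact GradedPiece.sigma_ext (add_comm 0 i) (by
      change (r • (1 : A)) * a = a * (r • (1 : A))
      simp)
  smul_def := by
    rintro r ⟨i, ⟨a⟩⟩
    exact GradedPiece.sigma_ext (zero_add i).symm (by
      change r • (a : A) = (r • (1 : A)) * a
      simp)

end AssociatedGraded

section CoradicalFiltrationLemmas

variable {k C : Type*} [Field k] [AddCommGroup C] [Module k C]

theorem range_map_mono {X X' Y Y' : Submodule k C} (hX : X ≤ X') (hY : Y ≤ Y') :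
    LinearMap.range (TensorProduct.map X.subtype Y.subtype) ≤
      LinearMap.range (TensorProduct.map X'.subtype Y'.subtype) := by
  rw [← Submodule.subtype_comp_inclusion X X' hX, ← Submodule.subtype_comp_inclusion Y Y' hY,
    TensorProduct.map_comp]
  exact LinearMap.range_comp_le_range _ _

theorem range_map_le_lTensor (X Y : Submodule k C) :
    LinearMap.range (TensorProduct.map X.subtype Y.subtype) ≤
      LinearMap.range (Y.subtype.lTensor C) := by
  rw [← LinearMap.lTensor_comp_rTensor]
  exact LinearMap.range_comp_le_range _ _

theorem range_map_le_rTensor (X Y : Submodule k C) :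
    LinearMap.range (TensorProduct.map X.subtype Y.subtype) ≤
      LinearMap.range (X.subtype.rTensor C) := by
  rw [← LinearMap.rTensor_comp_lTensor]
  exact LinearMap.range_comp_le_range _ _

theorem range_lTensor_eq_ker (M : Type*) [AddCommGroup M] [Module k M] (Y : Submodule k C) :
    LinearMap.range (Y.subtype.lTensor M) = LinearMap.ker (Y.mkQ.lTensor M) :=
  (LinearMap.exact_iff.mp
    (lTensor_exact M (LinearMap.exact_subtype_mkQ Y) Y.mkQ_surjective)).symm

theorem range_rTensor_inf_range_lTensor (X Y : Submodule k C) :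
    LinearMap.range (X.subtype.rTensor C) ⊓ LinearMap.range (Y.subtype.lTensor C) ≤
      LinearMap.range (TensorProduct.map X.subtype Y.subtype) := by
  rintro _ ⟨⟨w, rfl⟩, hz⟩
  rw [SetLike.mem_coe, range_lTensor_eq_ker, LinearMap.mem_ker, ← LinearMap.comp_apply,
    LinearMap.lTensor_comp_rTensor, ← LinearMap.rTensor_comp_lTensor, LinearMap.comp_apply] at hz
  have hw : w ∈ LinearMap.ker (Y.mkQ.lTensor X) :=
    Module.Flat.rTensor_preserves_injective_linearMap (M := C ⧸ Y) X.subtype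
      X.injective_subtype (hz.trans (map_zero _).symm)
  rw [← range_lTensor_eq_ker] at hw
  obtain ⟨v, rfl⟩ := hw
  refine ⟨v, ?_⟩
  rw [← LinearMap.comp_apply, LinearMap.rTensor_comp_lTensor]

variable [Coalgebra k C]

theorem isSubcoalgebra_coradical : IsSubcoalgebra k (coradical k C) := by
  suffices h : coradical k C ≤ Submodule.comap (comul (R := k) (A := C))
      (LinearMap.range (TensorProduct.map (coradical k C).subtype (coradical k C).subtype)) from
    fun x hx => h hx
  refine sSup_le fun D hD x hx => ?_
  exact range_map_mono (le_sSup hD) (le_sSup hD) (hD.isSubcoalgebra x hx)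

theorem coalgebraWedge_eq_ker (X Y : Submodule k C) :
    coalgebraWedge k X Y = LinearMap.ker (TensorProduct.map X.mkQ Y.mkQ ∘ₗ comul) := by
  rw [LinearMap.ker_comp, TensorProduct.map_ker (LinearMap.exact_subtype_mkQ X) X.mkQ_surjective
      (LinearMap.exact_subtype_mkQ Y) Y.mkQ_surjective, sup_comm]
  rfl

/-- If `Δ(X) ⊆ C ⊗ X`, then `Δ(X ∧ Y) ⊆ C ⊗ (X ∧ Y)`. -/
theorem comul_mem_of_mem_wedge {X Y : Submodule k C}
    (hX : ∀ x ∈ X, comul (R := k) x ∈ LinearMap.range (X.subtype.lTensor C))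
    {x : C} (hx : x ∈ coalgebraWedge k X Y) :
    comul (R := k) x ∈ LinearMap.range ((coalgebraWedge k X Y).subtype.lTensor C) := by
  have hker : LinearMap.range ((coalgebraWedge k X Y).subtype.lTensor C) =
      LinearMap.ker ((TensorProduct.map X.mkQ Y.mkQ ∘ₗ comul (R := k) (A := C)).lTensor C) := by
    rw [coalgebraWedge_eq_ker]
    exact (LinearMap.exact_iff.mp (Module.Flat.lTensor_exact C
      (LinearMap.exact_subtype_ker_map _))).symm
  rw [hker, LinearMap.mem_ker, LinearMap.lTensor_comp, LinearMap.comp_apply]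
  have hco := Coalgebra.coassoc_apply (R := k) x
  rw [← hco]
  have hcomp : (TensorProduct.map X.mkQ Y.mkQ).lTensor C ∘ₗ
      (TensorProduct.assoc k C C C).toLinearMap ∘ₗ (comul (R := k) (A := C)).rTensor C =
      (TensorProduct.assoc k C (C ⧸ X) (C ⧸ Y)).toLinearMap ∘ₗ
        TensorProduct.map (X.mkQ.lTensor C ∘ₗ comul) Y.mkQ := by
    refine TensorProduct.ext' fun a b => ?_
    simp only [LinearMap.comp_apply, LinearMap.rTensor_tmul, TensorProduct.map_tmul]
    induction comul (R := k) a with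
    | zero => simp
    | tmul u v => simp
    | add u v hu hv => simp only [TensorProduct.add_tmul, map_add, hu, hv]
  have h1 := LinearMap.congr_fun hcomp (comul x)
  simp only [LinearMap.comp_apply] at h1
  refine h1.trans ?_
  suffices TensorProduct.map (X.mkQ.lTensor C ∘ₗ comul) Y.mkQ (comul (R := k) x) = 0 by
    rw [this, map_zero]
  rw [← LinearMap.mem_ker]
  have hx' : comul (R := k) x ∈
      LinearMap.range (X.subtype.rTensor C) ⊔ LinearMap.range (Y.subtype.lTensor C) := hx
  refine (sup_le ?_ ?_ : _ ≤ LinearMap.ker _) hx'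
  · rw [LinearMap.range_le_ker_iff]
    refine TensorProduct.ext' fun a b => ?_
    have ha := hX a a.2
    rw [range_lTensor_eq_ker, LinearMap.mem_ker] at ha
    simp [ha]
  · rw [LinearMap.range_le_ker_iff]
    refine TensorProduct.ext' fun a b => ?_
    have hb : Y.mkQ (b : C) = 0 := (Submodule.Quotient.mk_eq_zero Y).mpr b.2
    simp only [LinearMap.comp_apply, LinearMap.lTensor_tmul, Submodule.subtype_apply,
      TensorProduct.map_tmul, hb, TensorProduct.tmul_zero, LinearMap.zero_apply]

theorem comul_mem_lTensor_coradicalFiltration (n : ℕ) {x : C}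
    (hx : x ∈ coradicalFiltration k C n) :
    comul (R := k) x ∈ LinearMap.range ((coradicalFiltration k C n).subtype.lTensor C) := by
  cases n with
  | zero => exact range_map_le_lTensor _ _ (isSubcoalgebra_coradical x hx)
  | succ n =>
    exact comul_mem_of_mem_wedge
      (fun x hx => range_map_le_lTensor _ _ (isSubcoalgebra_coradical x hx)) hx

theorem shift_le_coradicalFiltration (n : ℕ) :
    shiftFiltration (coradicalFiltration k C) n ≤ coradicalFiltration k C n := by
  cases n with
  | zero => exact bot_le
  | succ n =>
    intro x hx
    exact Submodule.mem_sup_right (comul_mem_lTensor_coradicalFiltration n hx)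

theorem comul_mem_of_mem_coradicalFiltration (n : ℕ) {x : C}
    (hx : x ∈ coradicalFiltration k C n) :
    comul (R := k) x ∈
      LinearMap.range (TensorProduct.map (coradical k C).subtype
        (coradicalFiltration k C n).subtype) ⊔
      LinearMap.range ((shiftFiltration (coradicalFiltration k C) n).subtype.lTensor C) := by
  cases n with
  | zero => exact Submodule.mem_sup_left (isSubcoalgebra_coradical x hx)
  | succ n =>
    have h1 := comul_mem_lTensor_coradicalFiltration (n + 1) hx
    have h2 : comul (R := k) x ∈ LinearMap.range ((coradical k C).subtype.rTensor C) ⊔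
      LinearMap.range ((coradicalFiltration k C n).subtype.lTensor C) := hx
    obtain ⟨a, ha, b, hb, hab⟩ := Submodule.mem_sup.mp h2
    have hle : LinearMap.range ((coradicalFiltration k C n).subtype.lTensor C) ≤
        LinearMap.range ((coradicalFiltration k C (n + 1)).subtype.lTensor C) := by
      have h : coradicalFiltration k C n ≤ coradicalFiltration k C (n + 1) :=
        shift_le_coradicalFiltration (n + 1)
      rw [← Submodule.subtype_comp_inclusion _ _ h, LinearMap.lTensor_comp]
      exact LinearMap.range_comp_le_range _ _
    have ha' : a ∈ LinearMap.range ((coradicalFiltration k C (n + 1)).subtype.lTensor C) := by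
      rw [eq_sub_of_add_eq hab]
      exact sub_mem h1 (hle hb)
    exact Submodule.mem_sup.mpr
      ⟨a, range_rTensor_inf_range_lTensor _ _ ⟨ha, ha'⟩, b, hb, hab⟩

theorem mem_coradicalFiltration_of_comul_mem (n : ℕ) {x : C}
    (hx : comul (R := k) x ∈ LinearMap.range ((coradical k C).subtype.rTensor C) ⊔
      LinearMap.range ((shiftFiltration (coradicalFiltration k C) n).subtype.lTensor C)) :
    x ∈ coradicalFiltration k C n := by
  cases n with
  | zero =>
    have h : LinearMap.range ((coradical k C).subtype.rTensor C) ⊔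
      LinearMap.range ((shiftFiltration (coradicalFiltration k C) 0).subtype.lTensor C) ≤
      Submodule.comap ((TensorProduct.rid k C).toLinearMap ∘ₗ
        (counit (R := k) (A := C)).lTensor C) (coradical k C) := by
      refine sup_le ?_ ?_
      · rintro _ ⟨w, rfl⟩
        induction w with
        | zero => simp
        | tmul a b => simpa using Submodule.smul_mem _ _ a.2
        | add u v hu hv => rw [map_add]; exact add_mem hu hv
      · rintro _ ⟨w, rfl⟩
        induction w with
        | zero => simp
        | tmul a b =>
          have : (b : C) = 0 := by simpa [shiftFiltration] using b.2
          simp [this]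
        | add u v hu hv => rw [map_add]; exact add_mem hu hv
    have := h hx
    simpa [coradicalFiltration] using this
  | succ n => exact hx

end CoradicalFiltrationLemmas

section PointedHopf

variable {k H : Type*} [Field k] [Ring H] [HopfAlgebra k H]

theorem IsGroupLikeElem.mem_coradical {g : H} (hg : IsGroupLikeElem k g) : g ∈ coradical k H := by
  refine (le_sSup ?_ : k ∙ g ≤ coradical k H) (Submodule.mem_span_singleton_self g)
  refine ⟨fun x hx => ?_, ?_, fun E _ hE => ?_⟩
  · obtain ⟨c, rfl⟩ := Submodule.mem_span_singleton.mp hx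
    refine ⟨c • (⟨g, Submodule.mem_span_singleton_self g⟩ ⊗ₜ
      ⟨g, Submodule.mem_span_singleton_self g⟩), ?_⟩
    simp [hg.comul_eq_tmul_self]
  · simpa using hg.ne_zero
  · exact (nonzero_span_atom g hg.ne_zero).le_iff.mp hE

theorem one_mem_coradical : (1 : H) ∈ coradical k H :=
  IsGroupLikeElem.mem_coradical IsGroupLikeElem.one

theorem map_mul_map_mem {M N M' N' : Type*} [AddCommGroup M] [Module k M] [AddCommGroup N]
    [Module k N] [AddCommGroup M'] [Module k M'] [AddCommGroup N'] [Module k N']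
    (f : M →ₗ[k] H) (g : N →ₗ[k] H) (f' : M' →ₗ[k] H) (g' : N' →ₗ[k] H)
    (S : Submodule k (H ⊗[k] H))
    (h : ∀ a b c d, (f a * f' c) ⊗ₜ[k] (g b * g' d) ∈ S) (u : M ⊗[k] N) (v : M' ⊗[k] N') :
    TensorProduct.map f g u * TensorProduct.map f' g' v ∈ S := by
  induction u with
  | zero => simp
  | add p q hp hq => rw [map_add, add_mul]; exact add_mem hp hq
  | tmul a b =>
    induction v with
    | zero => simp
    | add p q hp hq => rw [map_add, mul_add]; exact add_mem hp hq
    | tmul c d => simpa using h a b c d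

variable [IsPointedCoalgebra k H]

theorem coradical_eq_span_groupLike :
    coradical k H = Submodule.span k {g : H | IsGroupLikeElem k g} := by
  refine le_antisymm (sSup_le fun D hD => ?_) (Submodule.span_le.mpr fun g hg => hg.mem_coradical)
  obtain ⟨⟨v, hvD⟩, hv0, hv⟩ := finrank_eq_one_iff'.mp (IsPointedCoalgebra.finrank_eq_one D hD)
  have hv0 : v ≠ 0 := fun h => hv0 (Subtype.ext h)
  have hspan : ∀ w ∈ D, ∃ c : k, c • v = w := fun w hw => by
    obtain ⟨c, hc⟩ := hv ⟨w, hw⟩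
    exact ⟨c, congrArg Subtype.val hc⟩
  have hc : ∃ c : k, comul (R := k) v = c • (v ⊗ₜ[k] v) := by
    obtain ⟨w, hw⟩ := hD.isSubcoalgebra v hvD
    rw [← hw]
    clear hw
    induction w with
    | zero => exact ⟨0, by simp⟩
    | tmul a b =>
      obtain ⟨c, hc⟩ := hspan a a.2
      obtain ⟨d, hd⟩ := hspan b b.2
      refine ⟨c * d, ?_⟩
      simp [← hc, ← hd, TensorProduct.smul_tmul', TensorProduct.tmul_smul, mul_smul, smul_comm c d]
    | add u w hu hw =>
      obtain ⟨c, hc⟩ := hu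
      obtain ⟨d, hd⟩ := hw
      exact ⟨c + d, by rw [map_add, hc, hd, add_smul]⟩
  obtain ⟨c, hc⟩ := hc
  have hcounit : c * counit (R := k) v = 1 := by
    have h := Coalgebra.rTensor_counit_comul (R := k) v
    rw [hc] at h
    have h2 := congrArg (TensorProduct.lid k H) h
    simp only [map_smul, LinearMap.rTensor_tmul, TensorProduct.lid_tmul, one_smul] at h2
    rw [smul_smul] at h2
    have h3 : (c * counit (R := k) v - 1) • v = 0 := by rw [sub_smul, h2, one_smul, sub_self]
    exact sub_eq_zero.mp ((smul_eq_zero.mp h3).resolve_right hv0)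
  have hg : IsGroupLikeElem k (c • v) := by
    refine ⟨by simpa using hcounit, ?_⟩
    rw [map_smul, hc, TensorProduct.smul_tmul', TensorProduct.tmul_smul, TensorProduct.smul_tmul']
  have hc0 : c ≠ 0 := fun h => by simp [h] at hcounit
  intro w hw
  obtain ⟨d, rfl⟩ := hspan w hw
  have : d • v = (d * c⁻¹) • (c • v) := by rw [smul_smul, mul_assoc, inv_mul_cancel₀ hc0, mul_one]
  rw [this]
  exact Submodule.smul_mem _ _ (Submodule.subset_span hg)

theorem mul_mem_coradical {x y : H} (hx : x ∈ coradical k H) (hy : y ∈ coradical k H) :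
    x * y ∈ coradical k H := by
  have h := Submodule.mul_mem_mul hx hy
  rw [coradical_eq_span_groupLike, Submodule.span_mul_span] at h
  refine Submodule.span_le.mpr ?_ h
  rintro _ ⟨a, ha, b, hb, rfl⟩
  exact IsGroupLikeElem.mem_coradical (IsGroupLikeElem.mul ha hb)

variable (k H) in
/-- The coradical of a pointed Hopf algebra, as a subalgebra. -/
def coradicalSubalgebra : Subalgebra k H :=
  (coradical k H).toSubalgebra one_mem_coradical fun _ _ hx hy => mul_mem_coradical hx hy

theorem mul_mem_coradicalFiltration (s : ℕ) : ∀ i j : ℕ, i + j = s → ∀ x y : H,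
    x ∈ coradicalFiltration k H i → y ∈ coradicalFiltration k H j →
      x * y ∈ coradicalFiltration k H s := by
  induction s using Nat.strong_induction_on with
  | _ s ih =>
  intro i j hij x y hx hy
  have hL : ∀ a ∈ shiftFiltration (coradicalFiltration k H) i, ∀ b ∈ coradicalFiltration k H j,
      a * b ∈ shiftFiltration (coradicalFiltration k H) s := by
    intro a ha b hb
    cases i with
    | zero =>
      obtain rfl : a = 0 := by simpa [shiftFiltration] using ha
      simp
    | succ i =>
      obtain rfl : s = (i + j) + 1 := by omega
      exact ih (i + j) (by omega) i j rfl a b ha hb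
  have hR : ∀ a ∈ coradicalFiltration k H i, ∀ b ∈ shiftFiltration (coradicalFiltration k H) j,
      a * b ∈ shiftFiltration (coradicalFiltration k H) s := by
    intro a ha b hb
    cases j with
    | zero =>
      obtain rfl : b = 0 := by simpa [shiftFiltration] using hb
      simp
    | succ j =>
      obtain rfl : s = (i + j) + 1 := by omega
      exact ih (i + j) (by omega) i j rfl a b ha hb
  apply mem_coradicalFiltration_of_comul_mem
  rw [Bialgebra.comul_mul]
  have hl : ∀ (a b : H), b ∈ shiftFiltration (coradicalFiltration k H) s →
      a ⊗ₜ[k] b ∈ LinearMap.range ((coradical k H).subtype.rTensor H) ⊔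
        LinearMap.range ((shiftFiltration (coradicalFiltration k H) s).subtype.lTensor H) :=
    fun a b hb => Submodule.mem_sup_right ⟨a ⊗ₜ ⟨b, hb⟩, rfl⟩
  have hr : ∀ (a b : H), a ∈ coradical k H →
      a ⊗ₜ[k] b ∈ LinearMap.range ((coradical k H).subtype.rTensor H) ⊔
        LinearMap.range ((shiftFiltration (coradicalFiltration k H) s).subtype.lTensor H) :=
    fun a b ha => Submodule.mem_sup_left ⟨⟨a, ha⟩ ⊗ₜ b, rfl⟩
  obtain ⟨_, ⟨u, rfl⟩, _, ⟨v, rfl⟩, huv⟩ :=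
    Submodule.mem_sup.mp (comul_mem_of_mem_coradicalFiltration i hx)
  obtain ⟨_, ⟨u', rfl⟩, _, ⟨v', rfl⟩, huv'⟩ :=
    Submodule.mem_sup.mp (comul_mem_of_mem_coradicalFiltration j hy)
  generalize LinearMap.range ((coradical k H).subtype.rTensor H) ⊔
    LinearMap.range ((shiftFiltration (coradicalFiltration k H) s).subtype.lTensor H) = S at hl hr ⊢
  rw [← huv, ← huv', add_mul, mul_add, mul_add]
  unfold LinearMap.lTensor
  refine add_mem (add_mem ?_ ?_) (add_mem ?_ ?_) <;>
    refine map_mul_map_mem _ _ _ _ _ (fun a b c d => ?_) _ _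
  · exact hr _ _ (mul_mem_coradical a.2 c.2)
  · exact hl _ _ (hR _ b.2 _ d.2)
  · exact hl _ _ (hL _ b.2 _ d.2)
  · exact hl _ _ (hL _ b.2 _ (shift_le_coradicalFiltration j d.2))

instance coradicalFiltration.gradedMonoid :
    SetLike.GradedMonoid (coradicalFiltration k H) where
  one_mem := one_mem_coradical
  mul_mem i j x y hx hy := mul_mem_coradicalFiltration (i + j) i j rfl x y hx hy

variable (k H) in
/-- The underlying algebra of the graded Hopf algebra `gr_c H = ⨁ₙ Hₙ/Hₙ₋₁` associated to the
coradical filtration of a pointed Hopf algebra. -/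
abbrev coradicalGraded : Type _ := ⨁ n, GradedPiece (coradicalFiltration k H) n

end PointedHopf

/-! ### Separating tensors by linear functionals. -/

section TensorSeparation

variable {k M N : Type*} [Field k] [AddCommGroup M] [Module k M] [AddCommGroup N] [Module k N]

/-! Projection to degree zero makes the coradical `H₀` a quotient ring of `gr_c H`, so `H₀` is
Noetherian on the same side. As `H` is pointed, `H₀` is the group algebra of the group-like
elements, and a group with a one-sided Noetherian group algebra is finitely generated
(`group_fg_of_isNoetherianRing_monoidAlgebra` and its opposite version). Hence `H₀` is affine.

The irrelevant ideal of `gr_c H` is finitely generated on that side. Lifting the homogeneous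
components of its generators gives a finite set `T` such that every element of `Hₙ₊₁` is, modulo
`Hₙ`, a sum of products of an element of `T` with one of strictly lower filtration degree
(`exists_finite_leadingProducts`). By induction on `n`, `H₀` and `T` generate every `Hₙ`, and their
classes generate `gr_c H`.

For `H` itself it remains that the `Hₙ` exhaust `H` (`exists_mem_coradicalFiltration`), which is
true of any coalgebra `C`. The convolution algebra `C*` acts on a finite-dimensional coideal
containing a given `x`, through a finite-dimensional algebra `R`. The kernel of each simple quotient
of `R`, pulled back to `C*`, has a simple subcoalgebra as its orthogonal. So the annihilator `I` of
the coradical maps into the Jacobson radical of `R`, which is nilpotent. Some `I ^ (n + 1)`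
therefore kills `x`, which forces `x ∈ Cₙ`. -/

theorem tensor_eq_zero_of_forall_dual_left (t : M ⊗[k] N)
    (h : ∀ φ : M →ₗ[k] k, TensorProduct.lid k N (φ.rTensor N t) = 0) : t = 0 := by
  classical
  let b := Module.Basis.ofVectorSpace k M
  refine (TensorProduct.equivFinsuppOfBasisLeft (N := N) b).injective ?_
  rw [map_zero]
  ext i
  rw [TensorProduct.equivFinsuppOfBasisLeft_apply]
  exact h (b.coord i)

theorem tensor_eq_zero_of_forall_dual_right (t : M ⊗[k] N)
    (h : ∀ φ : N →ₗ[k] k, TensorProduct.rid k M (φ.lTensor M t) = 0) : t = 0 := by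
  classical
  let b := Module.Basis.ofVectorSpace k N
  refine (TensorProduct.equivFinsuppOfBasisRight (M := M) b).injective ?_
  rw [map_zero]
  ext i
  rw [TensorProduct.equivFinsuppOfBasisRight_apply]
  exact h (b.coord i)

theorem range_rTensor_eq_ker (X : Submodule k M) :
    LinearMap.range (X.subtype.rTensor N) = LinearMap.ker (X.mkQ.rTensor N) :=
  (LinearMap.exact_iff.mp
    (rTensor_exact N (LinearMap.exact_subtype_mkQ X) X.mkQ_surjective)).symm

theorem eq_of_forall_conv_apply_eq {a b : M} (h : ∀ g : WithConv (M →ₗ[k] k), g a = g b) :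
    a = b :=
  by
  rw [← sub_eq_zero, ← Module.forall_dual_apply_eq_zero_iff k]
  intro g
  rw [map_sub, sub_eq_zero]
  exact h (WithConv.toConv g)

end TensorSeparation

/-! ### The dual algebra acting on a coalgebra by contraction. -/

section DualActions

variable {k C : Type*} [Field k] [AddCommGroup C] [Module k C] [Coalgebra k C]

/-- Contraction of the first tensor leg of the comultiplication: `c ↦ f(c₁) c₂`. -/
noncomputable def comulContractLeft (f : C →ₗ[k] k) : C →ₗ[k] C :=
  (TensorProduct.lid k C).toLinearMap ∘ₗ f.rTensor C ∘ₗ comul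

/-- Contraction of the second tensor leg of the comultiplication: `c ↦ c₁ f(c₂)`. -/
noncomputable def comulContractRight (f : C →ₗ[k] k) : C →ₗ[k] C :=
  (TensorProduct.rid k C).toLinearMap ∘ₗ f.lTensor C ∘ₗ comul

/-- Left contraction by `f` is the transpose of left multiplication by `f` in the dual algebra;
right contraction is likewise the transpose of right multiplication. Coalgebra questions thereby
become questions about ideals. -/
theorem apply_comulContractLeft (f g : WithConv (C →ₗ[k] k)) (c : C) :
    g (comulContractLeft f.ofConv c) = (f * g) c := by
  have : g.ofConv ∘ₗ (TensorProduct.lid k C).toLinearMap ∘ₗ f.ofConv.rTensor C =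
      LinearMap.mul' k k ∘ₗ TensorProduct.map f.ofConv g.ofConv := by
    ext a b; simp
  exact LinearMap.congr_fun this (comul c)

theorem apply_comulContractRight (f g : WithConv (C →ₗ[k] k)) (c : C) :
    g (comulContractRight f.ofConv c) = (g * f) c := by
  have : g.ofConv ∘ₗ (TensorProduct.rid k C).toLinearMap ∘ₗ f.ofConv.lTensor C =
      LinearMap.mul' k k ∘ₗ TensorProduct.map g.ofConv f.ofConv := by
    ext a b; simp [mul_comm]
  exact LinearMap.congr_fun this (comul c)

theorem comulContractRight_mul (f g : WithConv (C →ₗ[k] k)) :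
    comulContractRight (f * g).ofConv = comulContractRight f.ofConv ∘ₗ
      comulContractRight g.ofConv := by
  ext c
  refine eq_of_forall_conv_apply_eq (k := k) fun h => ?_
  rw [LinearMap.comp_apply, apply_comulContractRight, apply_comulContractRight,
    apply_comulContractRight, mul_assoc]

theorem comulContractRight_one :
    comulContractRight (1 : WithConv (C →ₗ[k] k)).ofConv = LinearMap.id := by
  ext c
  refine eq_of_forall_conv_apply_eq (k := k) fun h => ?_
  rw [apply_comulContractRight, mul_one, LinearMap.id_apply]

theorem comulContractRight_add (f g : C →ₗ[k] k) :
    comulContractRight (f + g) = comulContractRight f + comulContractRight g := by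
  simp [comulContractRight, LinearMap.lTensor_add, LinearMap.add_comp, LinearMap.comp_add]

theorem comul_mem_range_lTensor_of_comulContractLeft {D : Submodule k C} {c : C}
    (h : ∀ f : C →ₗ[k] k, comulContractLeft f c ∈ D) :
    comul (R := k) c ∈ LinearMap.range (D.subtype.lTensor C) := by
  rw [range_lTensor_eq_ker, LinearMap.mem_ker]
  refine tensor_eq_zero_of_forall_dual_left _ fun φ => ?_
  have : (TensorProduct.lid k (C ⧸ D)).toLinearMap ∘ₗ φ.rTensor (C ⧸ D) ∘ₗ D.mkQ.lTensor C =
      D.mkQ ∘ₗ (TensorProduct.lid k C).toLinearMap ∘ₗ φ.rTensor C := by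
    ext a b; simp
  refine (LinearMap.congr_fun this (comul c)).trans ?_
  exact (Submodule.Quotient.mk_eq_zero D).mpr (h φ)

theorem comul_mem_range_rTensor_of_comulContractRight {D : Submodule k C} {c : C}
    (h : ∀ f : C →ₗ[k] k, comulContractRight f c ∈ D) :
    comul (R := k) c ∈ LinearMap.range (D.subtype.rTensor C) := by
  rw [range_rTensor_eq_ker, LinearMap.mem_ker]
  refine tensor_eq_zero_of_forall_dual_right _ fun φ => ?_
  have : (TensorProduct.rid k (C ⧸ D)).toLinearMap ∘ₗ φ.lTensor (C ⧸ D) ∘ₗ D.mkQ.rTensor C =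
      D.mkQ ∘ₗ (TensorProduct.rid k C).toLinearMap ∘ₗ φ.lTensor C := by
    ext a b; simp
  refine (LinearMap.congr_fun this (comul c)).trans ?_
  exact (Submodule.Quotient.mk_eq_zero D).mpr (h φ)

/-- Stability under the two contractions puts `Δ(D)` in `C ⊗ D` and in `D ⊗ C`, and over a field
these meet in `D ⊗ D`. -/
theorem isSubcoalgebra_of_comulContract_mem {D : Submodule k C}
    (hl : ∀ (f : C →ₗ[k] k), ∀ c ∈ D, comulContractLeft f c ∈ D)
    (hr : ∀ (f : C →ₗ[k] k), ∀ c ∈ D, comulContractRight f c ∈ D) : IsSubcoalgebra k D :=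
  fun c hc => range_rTensor_inf_range_lTensor D D
    ⟨comul_mem_range_rTensor_of_comulContractRight fun f => hr f c hc,
      comul_mem_range_lTensor_of_comulContractLeft fun f => hl f c hc⟩

theorem comulContractRight_mem_of_comul_mem {D : Submodule k C} {c : C}
    (h : comul (R := k) c ∈ LinearMap.range (D.subtype.rTensor C)) (f : C →ₗ[k] k) :
    comulContractRight f c ∈ D := by
  obtain ⟨w, hw⟩ := h
  change TensorProduct.rid k C (f.lTensor C (comul c)) ∈ D
  rw [← hw]
  clear hw
  induction w with
  | zero => simp
  | tmul a b => simpa using D.smul_mem _ a.2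
  | add u v hu hv => simp only [map_add]; exact add_mem hu hv

theorem comulContractRight_eq_zero_of_comul_mem {E : Submodule k C} {c : C}
    (h : comul (R := k) c ∈ LinearMap.range (E.subtype.lTensor C)) {f : C →ₗ[k] k}
    (hf : ∀ e ∈ E, f e = 0) : comulContractRight f c = 0 := by
  obtain ⟨w, hw⟩ := h
  change TensorProduct.rid k C (f.lTensor C (comul c)) = 0
  rw [← hw]
  clear hw
  induction w with
  | zero => simp
  | tmul a b => simp [hf]
  | add u v hu hv => simp only [map_add, hu, hv, add_zero]

/-- This makes the annihilator of a subcoalgebra a two-sided ideal of the dual algebra. -/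
theorem convMul_apply_eq_zero {E : Submodule k C} (hE : IsSubcoalgebra k E) {c : C} (hc : c ∈ E)
    {f g : WithConv (C →ₗ[k] k)} (h : (∀ e ∈ E, f e = 0) ∨ ∀ e ∈ E, g e = 0) :
    (f * g) c = 0 := by
  rw [LinearMap.convMul_apply]
  obtain ⟨w, hw⟩ := hE c hc
  rw [← hw]
  clear hw
  induction w with
  | zero => simp
  | tmul a b =>
    rcases h with h | h
    · have : f.ofConv a = 0 := h a a.2
      simp [this]
    · have : g.ofConv b = 0 := h b b.2
      simp [this]
  | add u v hu hv => simp only [map_add, hu, hv, add_zero]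

end DualActions

/-- The image of `L` is a two-sided ideal of `S`, hence zero or everything. In the second case `L`
contains some `x` with `ψ x = 1`, and `1 - x` lies in the kernel, so in `L`. -/
theorem le_ker_or_one_mem_of_isSimpleRing {A S : Type*} [Ring A] [Ring S] [IsSimpleRing S]
    (ψ : A →+* S) (hψ : Function.Surjective ψ) (L : AddSubgroup A)
    (hl : ∀ a, ∀ x ∈ L, a * x ∈ L) (hr : ∀ a, ∀ x ∈ L, x * a ∈ L)
    (hker : ∀ a, ψ a = 0 → a ∈ L) : (∀ x ∈ L, ψ x = 0) ∨ 1 ∈ L := by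
  let I : TwoSidedIdeal S := TwoSidedIdeal.mk' (ψ '' L) ⟨0, L.zero_mem, map_zero ψ⟩
    (by rintro _ _ ⟨x, hx, rfl⟩ ⟨y, hy, rfl⟩; exact ⟨x + y, L.add_mem hx hy, map_add ψ x y⟩)
    (by rintro _ ⟨x, hx, rfl⟩; exact ⟨-x, L.neg_mem hx, map_neg ψ x⟩)
    (by
      rintro s _ ⟨x, hx, rfl⟩
      obtain ⟨a, rfl⟩ := hψ s
      exact ⟨a * x, hl a x hx, map_mul ψ a x⟩)
    (by
      rintro _ s ⟨x, hx, rfl⟩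
      obtain ⟨a, rfl⟩ := hψ s
      exact ⟨x * a, hr a x hx, map_mul ψ x a⟩)
  have hI : ∀ s, s ∈ I ↔ s ∈ ψ '' L := fun s => TwoSidedIdeal.mem_mk' _ _ _ _ _ _ _
  rcases eq_bot_or_eq_top I with h | h
  · left
    intro x hx
    have : ψ x ∈ I := (hI _).mpr ⟨x, hx, rfl⟩
    rwa [h, TwoSidedIdeal.mem_bot] at this
  · right
    have : (1 : S) ∈ I := h ▸ TwoSidedIdeal.mem_top S
    obtain ⟨x, hx, hx1⟩ := (hI _).mp this
    have : (1 - x) ∈ L := hker _ (by rw [map_sub, map_one, hx1, sub_self])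
    simpa using L.add_mem this hx

/-! ### The coradical filtration is exhaustive. -/

section Exhaustion

variable {k C : Type*} [Field k] [AddCommGroup C] [Module k C] [Coalgebra k C]

/-- Functionals vanishing on the coradical are killed by every surjection from the dual algebra
to a simple ring that factors through the restriction to a finite-dimensional subspace. -/
theorem map_eq_zero_of_vanish_on_coradical {S : Type*} [Ring S] [IsSimpleRing S]
    (ψ : WithConv (C →ₗ[k] k) →+* S) (hψ : Function.Surjective ψ)
    (E : Submodule k C) [Module.Finite k E]
    (hE : ∀ f : WithConv (C →ₗ[k] k), (∀ e ∈ E, f e = 0) → ψ f = 0)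
    (f : WithConv (C →ₗ[k] k)) (hf : ∀ c ∈ coradical k C, f c = 0) : ψ f = 0 := by
  -- The orthogonal of `ker ψ`, shown below to be a simple subcoalgebra and hence contained in the
  -- coradical.
  let D : Submodule k C :=
    { carrier := {c | ∀ g : WithConv (C →ₗ[k] k), ψ g = 0 → g c = 0}
      add_mem' := fun {a b} ha hb g hg => by
        change g.ofConv (a + b) = 0
        rw [map_add]
        exact (congrArg₂ (· + ·) (ha g hg) (hb g hg)).trans (add_zero 0)
      zero_mem' := fun g _ => map_zero g.ofConv
      smul_mem' := fun r a ha g hg => by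
        change g.ofConv (r • a) = 0
        rw [map_smul]
        exact (congrArg (r • ·) (ha g hg)).trans (smul_zero r) }
  have hD : IsSubcoalgebra k D := by
    refine isSubcoalgebra_of_comulContract_mem (fun f c hc g hg => ?_) (fun f c hc g hg => ?_)
    · rw [show f = (WithConv.toConv f).ofConv from rfl, apply_comulContractLeft]
      exact hc _ (by rw [map_mul, hg, mul_zero])
    · rw [show f = (WithConv.toConv f).ofConv from rfl, apply_comulContractRight]
      exact hc _ (by rw [map_mul, hg, zero_mul])
  -- The annihilator of `B` is a two-sided ideal containing `ker ψ`, so by simplicity it lies in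
  -- `ker ψ` or contains the counit; the latter forces `B = ⊥`.
  have key : ∀ B : Submodule k C, IsSubcoalgebra k B → B ≤ D →
      (∀ g : WithConv (C →ₗ[k] k), (∀ b ∈ B, g b = 0) → ψ g = 0) ∨ B = ⊥ := by
    intro B hB hBD
    let L : AddSubgroup (WithConv (C →ₗ[k] k)) :=
      { carrier := {g | ∀ b ∈ B, g b = 0}
        add_mem' := fun {x y} hx hy b hb => by
          change x b + y b = 0
          rw [hx b hb, hy b hb, add_zero]
        zero_mem' := fun b _ => rfl
        neg_mem' := fun {x} hx b hb => by
          change -(x b) = 0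
          rw [hx b hb, neg_zero] }
    rcases le_ker_or_one_mem_of_isSimpleRing ψ hψ L
      (fun a x hx b hb => convMul_apply_eq_zero hB hb (Or.inr hx))
      (fun a x hx b hb => convMul_apply_eq_zero hB hb (Or.inl hx))
      (fun a ha b hb => hBD hb a ha) with h | h
    · exact Or.inl h
    · right
      rw [eq_bot_iff]
      intro b hb
      refine (Submodule.mem_bot k).mpr (eq_of_forall_conv_apply_eq (k := k) fun g => ?_)
      have : (g * 1) b = 0 := convMul_apply_eq_zero hB hb (Or.inr h)
      rw [mul_one] at this
      rw [this]
      exact (map_zero g.ofConv).symm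
  have hD0 : D ≠ ⊥ := by
    intro hbot
    -- Restrictions to `E` of functionals in `ker ψ`. If `D = ⊥`, finite-dimensional duality makes
    -- them all of `E*`, so the unit agrees on `E` with an element of `ker ψ`; then `ψ 1 = 0`, which
    -- is absurd.
    let W : Submodule k (Module.Dual k E) :=
      { carrier := {φ | ∃ g : WithConv (C →ₗ[k] k), ψ g = 0 ∧ ∀ e : E, g e = φ e}
        add_mem' := by
          rintro _ _ ⟨g, hg, h⟩ ⟨g', hg', h'⟩
          exact ⟨g + g', by rw [map_add, hg, hg', add_zero],
            fun e => (congrArg₂ (· + ·) (h e) (h' e) :)⟩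
        zero_mem' := ⟨0, map_zero ψ, fun _ => rfl⟩
        smul_mem' := by
          rintro r _ ⟨g, hg, h⟩
          refine ⟨r • g, ?_, fun e => (congrArg (r • ·) (h e) :)⟩
          rw [Algebra.smul_def, map_mul, hg, mul_zero] }
    have hW : W.dualCoannihilator = ⊥ := by
      rw [eq_bot_iff]
      intro e he
      rw [Submodule.mem_dualCoannihilator] at he
      have heD : (e : C) ∈ D := fun g hg =>
        he (g.ofConv ∘ₗ E.subtype) ⟨g, hg, fun _ => rfl⟩
      rw [hbot, Submodule.mem_bot] at heD
      exact (Submodule.mem_bot k).mpr (Subtype.ext heD)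
    have hWtop : W = ⊤ := by
      rw [← Subspace.dualCoannihilator_dualAnnihilator_eq (W := W), hW,
        Submodule.dualAnnihilator_bot]
    obtain ⟨g, hg, h⟩ : (1 : WithConv (C →ₗ[k] k)).ofConv ∘ₗ E.subtype ∈ W :=
      hWtop ▸ Submodule.mem_top
    have h1 : ψ (1 - g) = 0 := hE _ fun e he => by
      change (1 : WithConv (C →ₗ[k] k)) e - g e = 0
      exact sub_eq_zero.mpr (h ⟨e, he⟩).symm
    rw [map_sub, hg, sub_zero, map_one] at h1
    exact one_ne_zero h1
  have hsimple : IsSimpleSubcoalgebra k D := by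
    refine ⟨hD, hD0, fun B hB hBD => ?_⟩
    rcases key B hB hBD with h | h
    · refine Or.inr (le_antisymm hBD fun c hc => ?_)
      by_contra hcB
      obtain ⟨g, hgc, hgB⟩ := Submodule.exists_le_ker_of_notMem hcB
      exact hgc (hc (WithConv.toConv g) (h (WithConv.toConv g) fun b hb => hgB hb))
    · exact Or.inl h
  exact (key D hD le_rfl).resolve_right hD0 f fun d hd => hf d (le_sSup hsimple hd)

variable (k C) in
/-- The functionals vanishing on the coradical. -/
def coradicalAnnihilator : Submodule k (WithConv (C →ₗ[k] k)) where
  carrier := {f | ∀ c ∈ coradical k C, f c = 0}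
  add_mem' {f g} hf hg c hc := by
    change f c + g c = 0
    rw [hf c hc, hg c hc, add_zero]
  zero_mem' _ _ := rfl
  smul_mem' r f hf c hc := by
    change r • f c = 0
    rw [hf c hc, smul_zero]

/-- Let `I` be the annihilator of `C₀`. For `f ∈ I` and `g ∈ I ^ (n + 1)`, the product `f * g` lies
in `I ^ (n + 2)`, so `g` kills the contraction `f(c₁) c₂`, which lies in `Cₙ` by induction. Such `f`
separate `C / C₀`, whence `c ∈ C₀ ∧ Cₙ`. The exponent is `n + 1` because `I` itself cuts out `C₀`.
-/
theorem mem_coradicalFiltration_of_forall_pow (n : ℕ) : ∀ c : C,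
    (∀ f ∈ coradicalAnnihilator k C ^ (n + 1), f c = 0) → c ∈ coradicalFiltration k C n := by
  induction n with
  | zero =>
    intro c hc
    by_contra h
    obtain ⟨g, hgc, hg⟩ := Submodule.exists_le_ker_of_notMem h
    refine hgc (hc (WithConv.toConv g) ?_)
    rw [zero_add, Submodule.pow_one]
    exact fun b hb => hg hb
  | succ n ih =>
    intro c hc
    change c ∈ coalgebraWedge k (coradical k C) (coradicalFiltration k C n)
    set Y := coradicalFiltration k C n
    set X := coradical k C
    rw [coalgebraWedge_eq_ker, LinearMap.mem_ker]
    refine tensor_eq_zero_of_forall_dual_left _ fun φ => ?_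
    have hcomp : (TensorProduct.lid k (C ⧸ Y)).toLinearMap ∘ₗ φ.rTensor (C ⧸ Y) ∘ₗ
        TensorProduct.map X.mkQ Y.mkQ =
        Y.mkQ ∘ₗ (TensorProduct.lid k C).toLinearMap ∘ₗ (φ ∘ₗ X.mkQ).rTensor C := by
      ext a b; simp
    refine (LinearMap.congr_fun hcomp (comul c)).trans ?_
    refine (Submodule.Quotient.mk_eq_zero Y).mpr (ih _ fun g hg => ?_)
    refine (apply_comulContractLeft (WithConv.toConv (φ ∘ₗ X.mkQ)) g c).trans (hc _ ?_)
    rw [Submodule.pow_succ' _ n.succ_ne_zero]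
    refine Submodule.mul_mem_mul (fun b hb => ?_) hg
    change φ (X.mkQ b) = 0
    rw [show X.mkQ b = 0 from (Submodule.Quotient.mk_eq_zero X).mpr hb, map_zero]

/-- A finite-dimensional right coideal gives a representation of the dual algebra. -/
noncomputable def coidealRep (V : Submodule k C)
    (hV : ∀ f : C →ₗ[k] k, ∀ v ∈ V, comulContractRight f v ∈ V) :
    WithConv (C →ₗ[k] k) →ₐ[k] Module.End k V :=
  AlgHom.ofLinearMap
    { toFun := fun f => (comulContractRight f.ofConv).restrict (hV f.ofConv)
      map_add' := fun f g => by
        ext v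
        simp [comulContractRight_add]
      map_smul' := fun r f => by
        ext v
        simp [comulContractRight, LinearMap.lTensor_smul] }
    (by ext v; simp [comulContractRight_one])
    (fun f g => by ext v; simp [comulContractRight_mul])

/-- The orbit of `x` under the dual algebra works: it contains `x` through the counit, and it lies
in the span of the finitely many left legs of `Δ x`. -/
theorem exists_mem_finite_coideal (x : C) : ∃ V : Submodule k C, Module.Finite k V ∧ x ∈ V ∧
    ∀ f : C →ₗ[k] k, ∀ v ∈ V, comulContractRight f v ∈ V := by
  obtain ⟨D, hDfin, hD⟩ := TensorProduct.exists_finite_submodule_left_of_setFinite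
    {comul (R := k) x} (Set.finite_singleton _)
  have hD : comul (R := k) x ∈ LinearMap.range (D.subtype.rTensor C) := hD rfl
  let act : WithConv (C →ₗ[k] k) →ₗ[k] C :=
    { toFun := fun f => comulContractRight f.ofConv x
      map_add' := fun f g => by simp [comulContractRight_add]
      map_smul' := fun r f => by simp [comulContractRight, LinearMap.lTensor_smul] }
  have hle : LinearMap.range act ≤ D := by
    rintro _ ⟨f, rfl⟩
    exact comulContractRight_mem_of_comul_mem hD f.ofConv
  refine ⟨LinearMap.range act, Submodule.finiteDimensional_of_le hle, ⟨1, ?_⟩, ?_⟩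
  · change comulContractRight _ x = x
    rw [comulContractRight_one, LinearMap.id_apply]
  · rintro f _ ⟨g, rfl⟩
    refine ⟨WithConv.toConv f * g, ?_⟩
    change comulContractRight _ x = comulContractRight f (comulContractRight _ x)
    rw [comulContractRight_mul]
    rfl

theorem exists_finite_comul_mem (V : Submodule k C) [Module.Finite k V] :
    ∃ E : Submodule k C, Module.Finite k E ∧
      ∀ v ∈ V, comul (R := k) v ∈ LinearMap.range (E.subtype.lTensor C) := by
  obtain ⟨s, hs⟩ := Module.Finite.iff_fg.mp ‹Module.Finite k V›
  obtain ⟨E, hE, h⟩ := TensorProduct.exists_finite_submodule_right_of_setFinite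
    (comul (R := k) (A := C) '' s) (s.finite_toSet.image _)
  refine ⟨E, hE, fun v hv => ?_⟩
  rw [← hs] at hv
  exact (Submodule.span_le (p := Submodule.comap (comul (R := k) (A := C))
    (LinearMap.range (E.subtype.lTensor C)))).mpr
    (fun a ha => h ⟨a, ha, rfl⟩) hv

/-- By Wedderburn–Artin, `R` modulo its radical is a product of matrix rings over division rings;
`map_eq_zero_of_vanish_on_coradical` applies to each factor. -/
theorem map_mem_jacobson_of_vanish_on_coradical {R : Type*} [Ring R] [Algebra k R]
    [Module.Finite k R] (φ : WithConv (C →ₗ[k] k) →ₐ[k] R) (hφ : Function.Surjective φ)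
    (E : Submodule k C) [Module.Finite k E]
    (hE : ∀ f : WithConv (C →ₗ[k] k), (∀ e ∈ E, f e = 0) → φ f = 0)
    (f : WithConv (C →ₗ[k] k)) (hf : f ∈ coradicalAnnihilator k C) :
    φ f ∈ Ring.jacobson R := by
  have : IsArtinianRing R := IsArtinianRing.of_finite k R
  obtain ⟨n, D, d, _, hd, ⟨e⟩⟩ :=
    IsSemisimpleRing.exists_ringEquiv_pi_matrix_divisionRing (R ⧸ Ring.jacobson R)
  rw [← Ideal.Quotient.eq_zero_iff_mem]
  apply e.injective
  rw [map_zero]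
  funext i
  have := hd i
  let ψ : WithConv (C →ₗ[k] k) →+* Matrix (Fin (d i)) (Fin (d i)) (D i) :=
    (Pi.evalRingHom (fun i => Matrix (Fin (d i)) (Fin (d i)) (D i)) i).comp
      (e.toRingHom.comp ((Ideal.Quotient.mk (Ring.jacobson R)).comp φ.toRingHom))
  refine map_eq_zero_of_vanish_on_coradical ψ ?_ E (fun g hg => ?_) f hf
  · exact (Function.surjective_eval i).comp
      (e.surjective.comp (Ideal.Quotient.mk_surjective.comp hφ))
  · simp [ψ, hE g hg]

theorem exists_pow_coradicalAnnihilator_map_eq_zero {R : Type*} [Ring R] [Algebra k R]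
    [Module.Finite k R] (φ : WithConv (C →ₗ[k] k) →ₐ[k] R) (hφ : Function.Surjective φ)
    (E : Submodule k C) [Module.Finite k E]
    (hE : ∀ f : WithConv (C →ₗ[k] k), (∀ e ∈ E, f e = 0) → φ f = 0) :
    ∃ n, ∀ f ∈ coradicalAnnihilator k C ^ (n + 1), φ f = 0 := by
  have hJ := map_mem_jacobson_of_vanish_on_coradical φ hφ E hE
  have : IsArtinianRing R := IsArtinianRing.of_finite k R
  obtain ⟨n, hn⟩ := IsSemiprimaryRing.isNilpotent (R := R)
  have hpow : ∀ m, ∀ f ∈ coradicalAnnihilator k C ^ (m + 1), φ f ∈ Ring.jacobson R ^ (m + 1) := by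
    intro m
    induction m with
    | zero =>
      intro f hf
      rw [zero_add, Submodule.pow_one] at hf ⊢
      exact hJ f hf
    | succ m ih =>
      intro f hf
      rw [Submodule.pow_succ] at hf
      induction hf using Submodule.mul_induction_on' with
      | mem_mul_mem a ha b hb =>
        rw [map_mul, Submodule.pow_succ]
        exact Submodule.mul_mem_mul (ih a ha) (hJ b hb)
      | add a _ b _ ha hb => rw [map_add]; exact add_mem ha hb
  refine ⟨n, fun f hf => ?_⟩
  have h := hpow n f hf
  rw [Submodule.pow_succ, hn] at h
  simpa using h

theorem exists_mem_coradicalFiltration (x : C) : ∃ n, x ∈ coradicalFiltration k C n := by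
  obtain ⟨V, hVfin, hxV, hV⟩ := exists_mem_finite_coideal (k := k) x
  obtain ⟨E, hEfin, hE⟩ := exists_finite_comul_mem V
  obtain ⟨n, hn⟩ := exists_pow_coradicalAnnihilator_map_eq_zero
    (R := (coidealRep V hV).range) (coidealRep V hV).rangeRestrict
    (coidealRep V hV).rangeRestrict_surjective E fun f hf =>
      Subtype.ext (LinearMap.ext fun v => Subtype.ext
        (comulContractRight_eq_zero_of_comul_mem (hE v v.2) hf))
  refine ⟨n, mem_coradicalFiltration_of_forall_pow n x fun f hf => ?_⟩
  have h1 : comulContractRight f.ofConv x = 0 :=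
    congrArg Subtype.val (LinearMap.congr_fun (congrArg Subtype.val (hn f hf)) ⟨x, hxV⟩)
  -- The unit of the dual algebra is the counit, so `f x = ε(x₁ f(x₂))`.
  have h2 := apply_comulContractRight f 1 x
  rw [one_mul, h1] at h2
  rw [← h2]
  exact map_zero (1 : WithConv (C →ₗ[k] k)).ofConv

end Exhaustion

/-! ### Groups with a one-sided Noetherian group ring are finitely generated. -/

section GroupAlgebra

open MonoidAlgebra

variable {R G : Type*} [Ring R] [Group G]

/-- `K` need not be normal, so `G ⧸ K` gives no ring; translation of cosets still shows that the
kernel of `R[G] → R[G ⧸ K]` is a left ideal. -/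
theorem mapDomain_quotient_single_mul (K : Subgroup G) (g : G) (r : R) (x : MonoidAlgebra R G) :
    mapDomain (QuotientGroup.mk : G → G ⧸ K) (single g r * x) =
      MonoidAlgebra.map (AddMonoidHom.mulLeft r)
        (mapDomain (fun q : G ⧸ K => g • q) (mapDomain QuotientGroup.mk x)) := by
  induction x using MonoidAlgebra.induction_linear with
  | zero => simp [mapDomain_zero, MonoidAlgebra.map_zero]
  | add x y hx hy => rw [mul_add, mapDomain_add, hx, hy, mapDomain_add, mapDomain_add,
      MonoidAlgebra.map_add]
  | single h s =>
    rw [single_mul_single, mapDomain_single, mapDomain_single, mapDomain_single, map_single]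
    rfl

theorem mapDomain_quotient_mul_eq_zero (K : Subgroup G) (a x : MonoidAlgebra R G)
    (hx : mapDomain (QuotientGroup.mk : G → G ⧸ K) x = 0) :
    mapDomain (QuotientGroup.mk : G → G ⧸ K) (a * x) = 0 := by
  induction a using MonoidAlgebra.induction_linear with
  | zero => rw [zero_mul, mapDomain_zero]
  | add a b ha hb => rw [add_mul, mapDomain_add, ha, hb, add_zero]
  | single g r =>
    rw [mapDomain_quotient_single_mul, hx, mapDomain_zero, MonoidAlgebra.map_zero]

variable (R G) in
/-- A group whose group ring over a nontrivial ring is left Noetherian is finitely generated. -/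
theorem group_fg_of_isNoetherianRing_monoidAlgebra [Nontrivial R]
    [IsNoetherianRing (MonoidAlgebra R G)] : Group.FG G := by
  -- The augmentation left ideal is generated by finitely many of the elements `g - 1` themselves;
  -- these `g` will generate `G`.
  obtain ⟨s, hs, hspan⟩ := (Submodule.fg_span_iff_fg_span_finset_subset
    (R := MonoidAlgebra R G)
    (Set.range fun g : G => (single g 1 - single 1 1 : MonoidAlgebra R G))).mp
      (IsNoetherian.noetherian _)
  have hs : ∀ x ∈ s, ∃ g : G, single g 1 - single 1 1 = x := fun x hx => hs hx
  choose! γ hγ using hs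
  let K : Subgroup G := Subgroup.closure (γ '' s)
  have hmk : ∀ g h : G, mapDomain (QuotientGroup.mk : G → G ⧸ K)
      (single g 1 - single h 1 : MonoidAlgebra R G) =
        single (g : G ⧸ K) 1 - single (h : G ⧸ K) 1 := by
    intro g h
    rw [eq_sub_iff_add_eq, ← mapDomain_single (f := (QuotientGroup.mk : G → G ⧸ K)) (a := h),
      ← mapDomain_add, sub_add_cancel, mapDomain_single]
  have hzero : ∀ x ∈ Submodule.span (MonoidAlgebra R G) (s : Set (MonoidAlgebra R G)),
      mapDomain (QuotientGroup.mk : G → G ⧸ K) x = 0 := by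
    intro x hx
    induction hx using Submodule.span_induction with
    | mem x hx =>
      rw [← hγ x hx, hmk, sub_eq_zero]
      congr 1
      refine (QuotientGroup.eq.mpr ?_).symm
      simpa using Subgroup.subset_closure (Set.mem_image_of_mem γ hx)
    | zero => exact mapDomain_zero _
    | add x y _ _ hx hy => rw [mapDomain_add, hx, hy, add_zero]
    | smul a x _ hx => exact mapDomain_quotient_mul_eq_zero K a x hx
  refine ⟨⟨(s.finite_toSet.image γ).toFinset, ?_⟩⟩
  rw [Set.Finite.coe_toFinset, eq_top_iff]
  intro g _
  -- Since `g - 1` dies in `R[G ⧸ K]`, the cosets of `g` and `1` agree.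
  have hg := hzero (single g 1 - single 1 1) (hspan ▸ Submodule.subset_span ⟨g, rfl⟩)
  rw [hmk, sub_eq_zero, single_left_inj one_ne_zero] at hg
  simpa using QuotientGroup.eq.mp hg.symm

variable (R G) in
/-- A group whose group ring over a nontrivial ring is right Noetherian is finitely generated. -/
theorem group_fg_of_isNoetherianRing_op_monoidAlgebra [Nontrivial R]
    [IsNoetherianRing (MonoidAlgebra R G)ᵐᵒᵖ] : Group.FG G := by
  have : IsNoetherianRing (MonoidAlgebra Rᵐᵒᵖ Gᵐᵒᵖ) :=
    isNoetherianRing_of_ringEquiv _ MonoidAlgebra.opRingEquiv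
  have := group_fg_of_isNoetherianRing_monoidAlgebra Rᵐᵒᵖ Gᵐᵒᵖ
  exact Group.fg_of_surjective (f := (MulEquiv.inv' G).symm.toMonoidHom)
    (MulEquiv.inv' G).symm.surjective

end GroupAlgebra

/-! ### Lifting generators from the associated graded algebra. -/

section FilteredAlgebra

variable {k A : Type*} [Field k] [Ring A] [Algebra k A] (F : ℕ → Submodule k A)

/-- The quotient map from `Fₙ` to the homogeneous component `Fₙ / Fₙ₋₁`. -/
def GradedPiece.mkₗ (n : ℕ) : F n →ₗ[k] GradedPiece F n :=
  ((shiftFiltration F n).submoduleOf (F n)).mkQ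

theorem GradedPiece.mk_surjective (n : ℕ) :
    Function.Surjective (GradedPiece.mk n : F n → GradedPiece F n) :=
  Submodule.Quotient.mk_surjective _

/-- The inclusion of the degree zero component `F₀ / 0` in the algebra, and zero in other
degrees. -/
def gradedPieceToZero : ∀ n, GradedPiece F n →ₗ[k] A
  | 0 => ((shiftFiltration F 0).submoduleOf (F 0)).liftQ (F 0).subtype (fun _ hx => hx)
  | _ + 1 => 0

theorem gradedPieceToZero_zero_mk (x : F 0) :
    gradedPieceToZero F 0 (GradedPiece.mk 0 x) = x := rfl

/-- The span in `Fₙ` of the products, in either order, of an element of a lower filtration step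
with an element of `T`. -/
def leadingProducts (T : Set (Σ j, F j)) (n : ℕ) : Submodule k (F n) :=
  Submodule.span k {z | ∃ (i j : ℕ) (x : F i) (y : F j), i + j = n ∧ 0 < j ∧ ⟨j, y⟩ ∈ T ∧
    ((z : A) = x * y ∨ (z : A) = y * x)}

variable {F} in
theorem leadingProducts_mk_mem {T : Set (Σ j, F j)} {i j n : ℕ} (x : F i) {y : F j} (hj : 0 < j)
    (hy : ⟨j, y⟩ ∈ T) (h : i + j = n) {z : F n} (hz : (z : A) = x * y ∨ (z : A) = y * x) :
    GradedPiece.mk n z ∈ (leadingProducts F T n).map (GradedPiece.mkₗ F n) :=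
  ⟨z, Submodule.subset_span ⟨i, j, x, y, h, hj, hy, hz⟩, rfl⟩

variable {F} in
/-- A subalgebra containing `F₀` and a set of lifts of generators of the irrelevant ideal of the
associated graded algebra contains every `Fₙ`. -/
theorem filtration_le_subalgebra {T : Set (Σ j, F j)}
    (hT : ∀ n, ∀ h : F (n + 1),
      ∃ z ∈ leadingProducts F T (n + 1), GradedPiece.mk (n + 1) z = GradedPiece.mk (n + 1) h)
    (B : Subalgebra k A) (h0 : ∀ x ∈ F 0, x ∈ B) (hTB : ∀ t ∈ T, (t.2 : A) ∈ B) (n : ℕ) :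
    ∀ x ∈ F n, x ∈ B := by
  induction n using Nat.strong_induction_on with
  | _ n ih =>
  cases n with
  | zero => exact h0
  | succ n =>
    intro x hx
    obtain ⟨z, hz, hzx⟩ := hT n ⟨x, hx⟩
    have hzB : leadingProducts F T (n + 1) ≤
        Submodule.comap (F (n + 1)).subtype (Subalgebra.toSubmodule B) := by
      refine Submodule.span_le.mpr ?_
      rintro w ⟨i, j, a, y, hij, hj, hy, hw | hw⟩
      · change (w : A) ∈ B
        rw [hw]
        exact mul_mem (ih i (by omega) a a.2) (hTB _ hy)
      · change (w : A) ∈ B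
        rw [hw]
        exact mul_mem (hTB _ hy) (ih i (by omega) a a.2)
    -- Equal classes in degree `n + 1` differ by an element of `F n`.
    have hd : (z - x : A) ∈ B := ih n (Nat.lt_succ_self n) _ (GradedPiece.mk_eq_mk.mp hzx)
    have hz' : (z : A) ∈ B := hzB hz
    simpa using sub_mem hz' hd

variable [SetLike.GradedMonoid F]

/-- The projection of the associated graded algebra onto its degree zero component. -/
noncomputable def gradedToZero : (⨁ n, GradedPiece F n) →ₐ[k] A :=
  DirectSum.toAlgebra k (GradedPiece F) (gradedPieceToZero F) rfl (by
    rintro (_ | i) (_ | j) a b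
    · obtain ⟨x, rfl⟩ := GradedPiece.mk_surjective F 0 a
      obtain ⟨y, rfl⟩ := GradedPiece.mk_surjective F 0 b
      rfl
    · exact (mul_zero _).symm
    · exact (zero_mul _).symm
    · exact (zero_mul _).symm)

theorem gradedToZero_of (n : ℕ) (a : GradedPiece F n) :
    gradedToZero F (DirectSum.of _ n a) = gradedPieceToZero F n a :=
  DirectSum.toAddMonoid_of (fun i => (gradedPieceToZero F i).toAddMonoidHom) n a

theorem gradedToZero_apply (a : ⨁ n, GradedPiece F n) :
    gradedToZero F a = gradedPieceToZero F 0 (a 0) := by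
  induction a using DirectSum.induction_on with
  | zero => simp
  | add a b ha hb => rw [map_add, ha, hb, DirectSum.add_apply, map_add]
  | of n x =>
    rw [gradedToZero_of]
    cases n with
    | zero => rw [DirectSum.of_eq_same]
    | succ n => rw [DirectSum.of_eq_of_ne _ _ _ (by omega), map_zero]; rfl

theorem apply_zero_eq_zero_of_gradedToZero {a : ⨁ n, GradedPiece F n}
    (ha : gradedToZero F a = 0) : a 0 = 0 := by
  rw [gradedToZero_apply] at ha
  obtain ⟨x, hx⟩ := GradedPiece.mk_surjective F 0 (a 0)
  rw [← hx, gradedPieceToZero_zero_mk] at ha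
  rw [← hx, show x = 0 from Subtype.ext ha]
  rfl

/-- If the associated graded ring is left or right Noetherian, then its irrelevant ideal is
finitely generated on one side. -/
theorem exists_generators_ker_gradedToZero
    (hN : IsNoetherianRing (⨁ n, GradedPiece F n) ∨ IsNoetherianRing (⨁ n, GradedPiece F n)ᵐᵒᵖ) :
    ∃ (m : ℕ) (s : Fin m → ⨁ n, GradedPiece F n), (∀ i, s i 0 = 0) ∧
      ∀ a, gradedToZero F a = 0 → ∃ c : Fin m → ⨁ n, GradedPiece F n,
        a = ∑ i, c i * s i ∨ a = ∑ i, s i * c i := by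
  rcases hN with hN | hN
  · obtain ⟨m, s, hs⟩ := Submodule.fg_iff_exists_fin_generating_family.mp
      (IsNoetherian.noetherian (RingHom.ker (gradedToZero F)))
    refine ⟨m, s, fun i => apply_zero_eq_zero_of_gradedToZero F ?_, fun a ha => ?_⟩
    · exact hs.le (Submodule.subset_span ⟨i, rfl⟩)
    · obtain ⟨c, hc⟩ := (Submodule.mem_span_range_iff_exists_fun _).mp (hs.ge ha)
      exact ⟨c, Or.inl hc.symm⟩
  -- In the right Noetherian case the kernel is taken as a left ideal of the opposite ring.
  · obtain ⟨m, s, hs⟩ := Submodule.fg_iff_exists_fin_generating_family.mp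
      (IsNoetherian.noetherian (RingHom.ker (gradedToZero F).toRingHom.op))
    refine ⟨m, fun i => (s i).unop, fun i => apply_zero_eq_zero_of_gradedToZero F ?_,
      fun a ha => ?_⟩
    · have h : s i ∈ RingHom.ker (gradedToZero F).toRingHom.op :=
        hs.le (Submodule.subset_span ⟨i, rfl⟩)
      exact congrArg MulOpposite.unop h
    · have h : MulOpposite.op a ∈ RingHom.ker (gradedToZero F).toRingHom.op :=
        congrArg MulOpposite.op ha
      obtain ⟨c, hc⟩ := (Submodule.mem_span_range_iff_exists_fun _).mp (hs.ge h)
      refine ⟨fun i => (c i).unop, Or.inr ?_⟩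
      have := congrArg MulOpposite.unop hc
      simpa using this.symm

variable {F}

/-- By additivity `b` may be taken homogeneous; expanding `s` into components, only the one of
complementary degree contributes. `s 0 = 0` keeps the degree of the factor from `T` positive. -/
theorem component_mul_mem_leadingProducts {T : Set (Σ j, F j)} (n : ℕ)
    (s : ⨁ n, GradedPiece F n) (hs0 : s 0 = 0)
    (hs : ∀ j, s j ≠ 0 → ∃ y : F j, GradedPiece.mk j y = s j ∧ ⟨j, y⟩ ∈ T)
    (b : ⨁ n, GradedPiece F n) :
    (b * s) n ∈ (leadingProducts F T n).map (GradedPiece.mkₗ F n) ∧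
      (s * b) n ∈ (leadingProducts F T n).map (GradedPiece.mkₗ F n) := by
  classical
  induction b using DirectSum.induction_on with
  | zero =>
    rw [zero_mul, mul_zero, DirectSum.zero_apply]
    exact ⟨zero_mem _, zero_mem _⟩
  | add a b ha hb =>
    rw [add_mul, mul_add, DirectSum.add_apply, DirectSum.add_apply]
    exact ⟨add_mem ha.1 hb.1, add_mem ha.2 hb.2⟩
  | of i b =>
    obtain ⟨x, rfl⟩ := GradedPiece.mk_surjective F i b
    have hsupp : ∀ j ∈ DFinsupp.support s,
        0 < j ∧ ∃ y : F j, GradedPiece.mk j y = s j ∧ ⟨j, y⟩ ∈ T := by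
      intro j hj
      have hj : s j ≠ 0 := DFinsupp.mem_support_iff.mp hj
      exact ⟨Nat.pos_of_ne_zero (by rintro rfl; exact hj hs0), hs j hj⟩
    rw [← DirectSum.sum_support_of s, Finset.mul_sum, Finset.sum_mul, DFinsupp.finsetSum_apply,
      DFinsupp.finsetSum_apply]
    refine ⟨sum_mem fun j hj => ?_, sum_mem fun j hj => ?_⟩
    · obtain ⟨hj0, y, hy, hyT⟩ := hsupp j hj
      rw [DirectSum.of_mul_of, ← hy]
      by_cases h : i + j = n
      · subst h
        refine (DirectSum.of_eq_same (β := GradedPiece F) _ _).symm ▸ ?_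
        exact leadingProducts_mk_mem (z := ⟨x * y, SetLike.mul_mem_graded x.2 y.2⟩) x hj0 hyT rfl
          (Or.inl rfl)
      · refine (DirectSum.of_eq_of_ne (β := GradedPiece F) _ _ _ (Ne.symm h)).symm ▸ zero_mem _
    · obtain ⟨hj0, y, hy, hyT⟩ := hsupp j hj
      rw [DirectSum.of_mul_of, ← hy]
      by_cases h : j + i = n
      · subst h
        refine (DirectSum.of_eq_same (β := GradedPiece F) _ _).symm ▸ ?_
        exact leadingProducts_mk_mem (z := ⟨y * x, SetLike.mul_mem_graded y.2 x.2⟩) x hj0 hyT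
          (add_comm i j) (Or.inr rfl)
      · refine (DirectSum.of_eq_of_ne (β := GradedPiece F) _ _ _ (Ne.symm h)).symm ▸ zero_mem _

variable (F) in
-- `T` consists of one lift for each nonzero component of each generator of the irrelevant ideal.
-- Positive-degree classes lie in that ideal, and comparing components of degree `n + 1` gives the
-- claim.
theorem exists_finite_leadingProducts
    (hN : IsNoetherianRing (⨁ n, GradedPiece F n) ∨ IsNoetherianRing (⨁ n, GradedPiece F n)ᵐᵒᵖ) :
    ∃ T : Set (Σ j, F j), T.Finite ∧ ∀ n, ∀ h : F (n + 1),
      ∃ z ∈ leadingProducts F T (n + 1), GradedPiece.mk (n + 1) z = GradedPiece.mk (n + 1) h := by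
  classical
  obtain ⟨m, s, hs0, hs⟩ := exists_generators_ker_gradedToZero F hN
  choose lift hlift using GradedPiece.mk_surjective F
  refine ⟨⋃ i, (fun j => ⟨j, lift j (s i j)⟩) '' (DFinsupp.support (s i) : Set ℕ),
    Set.finite_iUnion fun i => (DFinsupp.support (s i)).finite_toSet.image _, fun n h => ?_⟩
  set T : Set (Σ j, F j) :=
    ⋃ i, (fun j => ⟨j, lift j (s i j)⟩) '' (DFinsupp.support (s i) : Set ℕ)
  have hT : ∀ i j, s i j ≠ 0 → ∃ y : F j, GradedPiece.mk j y = s i j ∧ ⟨j, y⟩ ∈ T :=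
    fun i j hj => ⟨lift j (s i j), hlift j _,
      Set.mem_iUnion.mpr ⟨i, j, DFinsupp.mem_support_iff.mpr hj, rfl⟩⟩
  obtain ⟨c, hc⟩ := hs (DirectSum.of _ (n + 1) (GradedPiece.mk (n + 1) h)) (gradedToZero_of F _ _)
  suffices GradedPiece.mk (n + 1) h ∈
      (leadingProducts F T (n + 1)).map (GradedPiece.mkₗ F (n + 1)) from this
  rw [← DirectSum.of_eq_same (β := GradedPiece F) (n + 1) (GradedPiece.mk (n + 1) h)]
  rcases hc with hc | hc
  · rw [hc, DFinsupp.finsetSum_apply]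
    exact sum_mem fun i _ => (component_mul_mem_leadingProducts _ _ (hs0 i) (hT i) _).1
  · rw [hc, DFinsupp.finsetSum_apply]
    exact sum_mem fun i _ => (component_mul_mem_leadingProducts _ _ (hs0 i) (hT i) _).2

theorem of_mk_eq_mul {i j n : ℕ} (a : F i) (b : F j) (c : F n) (h : i + j = n)
    (hc : (c : A) = a * b) :
    DirectSum.of (GradedPiece F) n (GradedPiece.mk n c) =
      DirectSum.of (GradedPiece F) i (GradedPiece.mk i a) *
        DirectSum.of (GradedPiece F) j (GradedPiece.mk j b) := by
  subst h
  rw [DirectSum.of_mul_of]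
  exact congrArg (DirectSum.of (GradedPiece F) (i + j))
    (congrArg (GradedPiece.mk (i + j)) (Subtype.ext hc))

theorem gradedPiece_mem_subalgebra {T : Set (Σ j, F j)}
    (hT : ∀ n, ∀ h : F (n + 1),
      ∃ z ∈ leadingProducts F T (n + 1), GradedPiece.mk (n + 1) z = GradedPiece.mk (n + 1) h)
    (B : Subalgebra k (⨁ n, GradedPiece F n))
    (h0 : ∀ x : F 0, DirectSum.of (GradedPiece F) 0 (GradedPiece.mk 0 x) ∈ B)
    (hTB : ∀ t ∈ T, DirectSum.of (GradedPiece F) t.1 (GradedPiece.mk t.1 t.2) ∈ B) (n : ℕ) :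
    ∀ x : F n, DirectSum.of (GradedPiece F) n (GradedPiece.mk n x) ∈ B := by
  induction n using Nat.strong_induction_on with
  | _ n ih =>
  cases n with
  | zero => exact h0
  | succ n =>
    intro x
    obtain ⟨z, hz, hzx⟩ := hT n x
    have hzB : leadingProducts F T (n + 1) ≤
        Submodule.comap (DirectSum.lof k ℕ (GradedPiece F) (n + 1) ∘ₗ GradedPiece.mkₗ F (n + 1))
          (Subalgebra.toSubmodule B) := by
      refine Submodule.span_le.mpr ?_
      rintro w ⟨i, j, a, y, hij, hj, hy, hw | hw⟩
      · change DirectSum.of (GradedPiece F) (n + 1) (GradedPiece.mk (n + 1) w) ∈ B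
        rw [of_mk_eq_mul a y w hij hw]
        exact mul_mem (ih i (by omega) a) (hTB _ hy)
      · change DirectSum.of (GradedPiece F) (n + 1) (GradedPiece.mk (n + 1) w) ∈ B
        rw [of_mk_eq_mul y a w ((add_comm j i).trans hij) hw]
        exact mul_mem (hTB _ hy) (ih i (by omega) a)
    rw [← hzx]
    exact hzB hz

/-- An exhaustively filtered algebra is affine if its associated graded ring is left or right
Noetherian and `F₀` is an affine subalgebra. -/
theorem finiteType_of_graded_noetherian
    (hN : IsNoetherianRing (⨁ n, GradedPiece F n) ∨ IsNoetherianRing (⨁ n, GradedPiece F n)ᵐᵒᵖ)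
    (hF : ∀ x : A, ∃ n, x ∈ F n)
    (B : Subalgebra k A) (hB : Subalgebra.toSubmodule B = F 0) [Algebra.FiniteType k B] :
    Algebra.FiniteType k A := by
  obtain ⟨T, hTfin, hT⟩ := exists_finite_leadingProducts F hN
  obtain ⟨s, hs, hsB⟩ := Subalgebra.fg_def.mp (Algebra.FiniteType.out (R := k) (A := B))
  refine ⟨Subalgebra.fg_def.mpr ⟨B.val '' s ∪ (fun t : Σ j, F j => (t.2 : A)) '' T,
    (hs.image _).union (hTfin.image _), eq_top_iff.mpr fun x _ => ?_⟩⟩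
  obtain ⟨n, hn⟩ := hF x
  refine filtration_le_subalgebra hT _ (fun x hx => ?_)
    (fun t ht => Algebra.subset_adjoin (Or.inr (Set.mem_image_of_mem _ ht))) n x hn
  refine Algebra.adjoin_mono Set.subset_union_left ?_
  rw [← AlgHom.map_adjoin, hsB]
  exact ⟨⟨x, hB.ge hx⟩, trivial, rfl⟩

/-- The inclusion of `F₀` in the associated graded algebra, as an algebra homomorphism. -/
noncomputable def zeroToGraded (B : Subalgebra k A) (hB : Subalgebra.toSubmodule B = F 0) :
    B →ₐ[k] ⨁ n, GradedPiece F n :=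
  AlgHom.ofLinearMap
    (DirectSum.lof k ℕ (GradedPiece F) 0 ∘ₗ GradedPiece.mkₗ F 0 ∘ₗ
      Submodule.inclusion (p := Subalgebra.toSubmodule B) hB.le)
    rfl
    (fun x y => of_mk_eq_mul (F := F) ⟨x, hB.le x.2⟩ ⟨y, hB.le y.2⟩
      ⟨x * y, hB.le (x * y).2⟩ (zero_add 0) rfl)

/-- A filtered algebra whose associated graded ring is left or right Noetherian has an affine
associated graded algebra if `F₀` is an affine subalgebra. -/
theorem finiteType_graded_of_noetherian
    (hN : IsNoetherianRing (⨁ n, GradedPiece F n) ∨ IsNoetherianRing (⨁ n, GradedPiece F n)ᵐᵒᵖ)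
    (B : Subalgebra k A) (hB : Subalgebra.toSubmodule B = F 0) [Algebra.FiniteType k B] :
    Algebra.FiniteType k (⨁ n, GradedPiece F n) := by
  obtain ⟨T, hTfin, hT⟩ := exists_finite_leadingProducts F hN
  obtain ⟨s, hs, hsB⟩ := Subalgebra.fg_def.mp (Algebra.FiniteType.out (R := k) (A := B))
  refine ⟨Subalgebra.fg_def.mpr ⟨zeroToGraded B hB '' s ∪
    (fun t : Σ j, F j => DirectSum.of (GradedPiece F) t.1 (GradedPiece.mk t.1 t.2)) '' T,
    (hs.image _).union (hTfin.image _), eq_top_iff.mpr fun x _ => ?_⟩⟩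
  induction x using DirectSum.induction_on with
  | zero => exact zero_mem _
  | add x y hx hy => exact add_mem (hx trivial) (hy trivial)
  | of n a =>
    obtain ⟨x, rfl⟩ := GradedPiece.mk_surjective F n a
    refine gradedPiece_mem_subalgebra hT _ (fun x => ?_)
      (fun t ht => Algebra.subset_adjoin (Or.inr ⟨t, ht, rfl⟩)) n x
    refine Algebra.adjoin_mono Set.subset_union_left ?_
    rw [← AlgHom.map_adjoin, hsB]
    exact ⟨⟨x, hB.ge x.2⟩, trivial, rfl⟩

/-- This passes the Noetherian condition from the graded ring down to `F 0`. -/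
theorem exists_surjective_gradedToZero (B : Subalgebra k A)
    (hB : Subalgebra.toSubmodule B = F 0) :
    ∃ π : (⨁ n, GradedPiece F n) →+* B, Function.Surjective π := by
  refine ⟨((gradedToZero F).codRestrict B fun a => ?_).toRingHom, fun b => ?_⟩
  · obtain ⟨x, hx⟩ := GradedPiece.mk_surjective F 0 (a 0)
    rw [gradedToZero_apply, ← hx, gradedPieceToZero_zero_mk]
    exact hB.ge x.2
  · refine ⟨DirectSum.of (GradedPiece F) 0 (GradedPiece.mk 0 ⟨b, hB.le b.2⟩), Subtype.ext ?_⟩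
    exact gradedToZero_of F 0 _

end FilteredAlgebra

/-! ### The coradical as a group algebra, and the conclusion. -/

section PointedHopfAffine

variable (k H : Type*) [Field k] [Ring H] [HopfAlgebra k H]

/-- Distinct group-like elements are linearly independent. -/
theorem lift_groupLike_injective :
    Function.Injective (MonoidAlgebra.lift k H (GroupLike k H) (GroupLike.valMonoidHom k H)) := by
  intro x y hxy
  refine MonoidAlgebra.coeff_injective (linearIndep_groupLikeVal (R := k) (A := H) ?_)
  simpa [MonoidAlgebra.lift_apply, Finsupp.linearCombination_apply] using hxy

variable [IsPointedCoalgebra k H]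

theorem range_lift_groupLike :
    (MonoidAlgebra.lift k H (GroupLike k H) (GroupLike.valMonoidHom k H)).range =
      coradicalSubalgebra k H := by
  refine le_antisymm ?_ fun x hx => ?_
  · rintro _ ⟨x, rfl⟩
    induction x using MonoidAlgebra.induction_linear with
    | zero => simp
    | add x y hx hy => simpa using add_mem hx hy
    | single g r =>
      simpa using Subalgebra.smul_mem _ (show (g : H) ∈ coradicalSubalgebra k H from
        g.2.mem_coradical) r
  · have hx : x ∈ coradical k H := hx
    rw [coradical_eq_span_groupLike] at hx
    refine (Submodule.span_le (p := Subalgebra.toSubmodule (AlgHom.range _))).mpr ?_ hx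
    intro g hg
    exact ⟨MonoidAlgebra.single ⟨g, hg⟩ 1, by simp⟩

/-- The coradical of a pointed Hopf algebra is the group algebra of its group-like elements. -/
noncomputable def groupLikeAlgEquivCoradical :
    MonoidAlgebra k (GroupLike k H) ≃ₐ[k] coradicalSubalgebra k H :=
  (AlgEquiv.ofInjective _ (lift_groupLike_injective k H)).trans
    (Subalgebra.equivOfEq _ _ (range_lift_groupLike k H))

theorem finiteType_coradicalSubalgebra
    (hN : IsNoetherianRing (coradicalSubalgebra k H) ∨
      IsNoetherianRing (coradicalSubalgebra k H)ᵐᵒᵖ) :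
    Algebra.FiniteType k (coradicalSubalgebra k H) := by
  have hG : Group.FG (GroupLike k H) := by
    rcases hN with hN | hN
    · have := isNoetherianRing_of_ringEquiv _ (groupLikeAlgEquivCoradical k H).symm.toRingEquiv
      exact group_fg_of_isNoetherianRing_monoidAlgebra k _
    · have := isNoetherianRing_of_ringEquiv _
        (RingEquiv.op (groupLikeAlgEquivCoradical k H).symm.toRingEquiv)
      exact group_fg_of_isNoetherianRing_op_monoidAlgebra k _
  exact (MonoidAlgebra.finiteType_iff_group_fg.mpr hG).equiv (groupLikeAlgEquivCoradical k H)

end PointedHopfAffine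

theorem corollary1p5 {k H : Type*} [Field k] [Ring H] [HopfAlgebra k H] [IsPointedCoalgebra k H]
    (hN : IsNoetherianRing (coradicalGraded k H) ∨ IsNoetherianRing (coradicalGraded k H)ᵐᵒᵖ) :
    Algebra.FiniteType k (coradicalSubalgebra k H) ∧
      Algebra.FiniteType k (coradicalGraded k H) ∧
      Algebra.FiniteType k H := by
  have hB : Subalgebra.toSubmodule (coradicalSubalgebra k H) = coradicalFiltration k H 0 :=
    Submodule.toSubalgebra_toSubmodule _ _ _
  obtain ⟨π, hπ⟩ := exists_surjective_gradedToZero (coradicalSubalgebra k H) hB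
  have h0 : Algebra.FiniteType k (coradicalSubalgebra k H) := by
    refine finiteType_coradicalSubalgebra k H (hN.imp (fun hN => ?_) fun hN => ?_)
    · exact isNoetherianRing_of_surjective _ _ π hπ (H := hN)
    · exact isNoetherianRing_of_surjective _ _ π.op (H := hN)
        (MulOpposite.op_surjective.comp (hπ.comp MulOpposite.unop_surjective))
  exact ⟨h0, finiteType_graded_of_noetherian hN _ hB,
    finiteType_of_graded_noetherian hN exists_mem_coradicalFiltration _ hB⟩
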